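/- **Conventions.** All logarithms are base $2$, and $\lceil x\rceil_2$ is the least power of two (among $1,2,4,\dots$) that is at least $x$. Matrices are Boolean, and $D(M)$ is the deterministic communication complexity of $M:R\times C\to\{0,1\}$: the least depth of a two-party protocol tree that computes $M$ and whose leaves are labelled by output bits. The $p$-fold interlace $M\langle p\rangle$ has rows $[p]\times R$, columns $C^p$ and entries $M\langle p\rangle((i,r),c)=M(r,c_i)$. For $0<x,y\le 1$, $D([M]_{p,x,y})$ is the least complexity of a submatrix of $M\langle p\rangle$ that has exactly $\lceil |R|x\rceil$ rows in each of the $p$ blocks and exactly $\lceil |C|^p y\rceil$ columns. For real $b\ge 0$ and $0<\delta\le \frac1{\sqrt2}-\frac12$, $M$ is *$(\delta,b)$-robust* if $D(M)\ge 1$ and $D([M]_{1,\,2^{-b},\,1/2+\delta})\ge D(M)$. A nonempty finite multiset $S$ of $q$-tuples over a finite set $C$ is *$(q,t)$-balanced with accuracy $\varepsilon$* if for every $J\subseteq[q]$ with $|J|\le t$ every pattern in $C^J$ occurs as the $J$-projection of the elements of $S$ (counted with multiplicity) with frequency between $(1-\varepsilon)/|C|^{|J|}$ and $(1+\varepsilon)/|C|^{|J|}$.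 The relaxed interlace $M\langle q,S\rangle$ has rows $[q]\times R$, one column for each element of $S$ (with multiplicity), and entries $((i,r),c)\mapsto M(r,c_i)$. **Parameters.** For a positive integer $d$ let $$q_1=\lceil 2\log^2 d\rceil_2-2,\quad t_1=\lceil 64\log d\rceil_2,\quad q_2=\lceil d\rceil_2,\quad t_2=\left\lceil \tfrac{3\log d}{\log\log d}\right\rceil_2,$$ $$\delta=0.1,\qquad b_1=2\log d,\qquad b_2=3\log\log d .$$ Let $\phi=[\,1\ \ 0\,]$ be the $1\times 2$ seed matrix. For a multiset $S_1$ of $q_1$-tuples of columns of $\phi$ put $\mathcal M_1=\phi\langle q_1,S_1\rangle$, and for a multiset $S_2$ of $q_2$-tuples of rows of $\mathcal M_1$ put $\mathcal M_2=\mathcal M_1^{T}\langle q_2,S_2\rangle$. **Statement.** 1. For every $d$ with $t_1\le q_1$, and every $S_1$ that is $(q_1,t_1)$-balanced with some accuracy $\varepsilon_1\in[0,1]$, the matrix $\mathcal M_1^{T}$ is $(\delta,b_1)$-robust. 2. There is $d_0$ such that for every $d\ge d_0$, every $S_1$ that is $(q_1,t_1)$-balanced with some accuracy $\varepsilon_1\in[0,1]$,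 and every $S_2$ that is $(q_2,t_2)$-balanced with some accuracy $\varepsilon_2\in[0,1]$, the matrix $\mathcal M_2^{T}$ is $(\delta,b_2)$-robust. -/

import Mathlib

open scoped Matrix

namespace InterlaceCC

/-! ### Deterministic communication complexity -/

/-- A deterministic two-party protocol tree: at an inner node the row player (`rowMsg`) or the
column player (`colMsg`) sends one bit that depends on their own input; a leaf outputs a bit. -/
inductive Protocol (X Y : Type) : Type where
  | output (v : Bool) : Protocol X Y
  | rowMsg (f : X → Bool) (ifFalse ifTrue : Protocol X Y) : Protocol X Y
  | colMsg (f : Y → Bool) (ifFalse ifTrue : Protocol X Y) : Protocol X Y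

namespace Protocol

/-- The output of the protocol on an input pair. -/
def eval {X Y : Type} : Protocol X Y → X → Y → Bool
  | output v, _, _ => v
  | rowMsg f P Q, x, y => if f x then Q.eval x y else P.eval x y
  | colMsg f P Q, x, y => if f y then Q.eval x y else P.eval x y

/-- The worst-case number of bits sent. -/
def depth {X Y : Type} : Protocol X Y → ℕ
  | output _ => 0
  | rowMsg _ P Q => max P.depth Q.depth + 1
  | colMsg _ P Q => max P.depth Q.depth + 1

end Protocol

/-- The deterministic communication complexity of a Boolean matrix. -/
noncomputable def comp {R C : Type} (M : Matrix R C Bool) : ℕ :=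
  sInf {k | ∃ P : Protocol R C, P.depth = k ∧ ∀ r c, P.eval r c = M r c}

/-! ### Interlacing, brackets, robustness -/

/-- The `p`-fold interlace of `M`: rows `[p] × R`, columns `C ^ p`. -/
def interlace {R C : Type} (M : Matrix R C Bool) (p : ℕ) :
    Matrix (Fin p × R) (Fin p → C) Bool :=
  Matrix.of fun x y => M x.2 (y x.1)

/-- The restriction of `M` to a set of rows and a set of columns. -/
def extract {R C : Type} (M : Matrix R C Bool) (R' : Finset R) (C' : Finset C) :
    Matrix {r // r ∈ R'} {c // c ∈ C'} Bool :=
  M.submatrix Subtype.val Subtype.val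

/-- `U ⊆ [k] × R` has exactly `T` rows in each of the `k` blocks. -/
def IsExactEquipartition {R : Type} [Fintype R] [DecidableEq R] {k : ℕ} (T : ℕ)
    (U : Finset (Fin k × R)) : Prop :=
  ∀ i : Fin k, (Finset.univ.filter fun r : R => (i, r) ∈ U).card = T

/-- The communication complexity of the bracket family `[M]_{p,x,y}`: the least complexity of a
submatrix of the `p`-fold interlace of the `m × n` matrix `M` with exactly `⌈m x⌉` rows in every
block and exactly `⌈n ^ p y⌉` columns. -/
noncomputable def bracketComp {R C : Type} [Fintype R] [DecidableEq R] [Fintype C]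
    (M : Matrix R C Bool) (p : ℕ) (x y : ℝ) : ℕ :=
  sInf {k | ∃ (R' : Finset (Fin p × R)) (C' : Finset (Fin p → C)),
    IsExactEquipartition ⌈(Fintype.card R : ℝ) * x⌉₊ R' ∧
    C'.card = ⌈(Fintype.card C : ℝ) ^ p * y⌉₊ ∧
    k = comp (extract (interlace M p) R' C')}

/-- `(δ, b)`-robust Boolean matrices. The depth `b` may be any nonnegative real, because depths
such as `3 log log d` need not be integers. -/
structure IsRobust {R C : Type} [Fintype R] [DecidableEq R] [Fintype C]
    (δ b : ℝ) (M : Matrix R C Bool) : Prop where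
  margin_pos : 0 < δ
  margin_le : δ ≤ 1 / Real.sqrt 2 - 1 / 2
  depth_nonneg : 0 ≤ b
  one_le_comp : 1 ≤ comp M
  comp_le_bracketComp : comp M ≤ bracketComp M 1 ((2 : ℝ) ^ (-b)) (1 / 2 + δ)

/-! ### Balanced column multisets and the relaxed interlace -/

/-- A nonempty multiset of `q`-tuples over `C`, listed with multiplicity as `S 0, …, S (s - 1)`, is
`(q, t)`-balanced with accuracy `ε` if for every set `J` of at most `t` coordinates every pattern
in `C ^ J` occurs with frequency `(1 ± ε) / |C| ^ |J|`. -/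
def IsBalanced {C : Type} [Fintype C] [DecidableEq C] {q s : ℕ} (t : ℕ) (ε : ℝ)
    (S : Fin s → Fin q → C) : Prop :=
  0 < s ∧ ∀ J : Finset (Fin q), J.card ≤ t → ∀ v : Fin q → C,
    |((Finset.univ.filter fun k : Fin s => ∀ j ∈ J, S k j = v j).card : ℝ) / (s : ℝ)
        - 1 / (Fintype.card C : ℝ) ^ J.card|
      ≤ ε / (Fintype.card C : ℝ) ^ J.card

/-- The relaxed interlace of order `q`: as the `q`-fold interlace, but only with the column tuples
in the multiset `S` (one column for each occurrence). -/
def relaxedInterlace {R C : Type} {q s : ℕ} (M : Matrix R C Bool) (S : Fin s → Fin q → C) :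
    Matrix (Fin q × R) (Fin s) Bool :=
  Matrix.of fun x k => M x.2 (S k x.1)

/-! ### Parameters; all logarithms are base 2 -/

/-- The least power of two that is at least `x`. -/
noncomputable def ceilPowTwo (x : ℝ) : ℕ :=
  sInf {n : ℕ | (∃ k : ℕ, n = 2 ^ k) ∧ x ≤ (n : ℝ)}

noncomputable def q₁ (d : ℕ) : ℕ := ceilPowTwo (2 * Real.logb 2 d ^ 2) - 2

noncomputable def t₁ (d : ℕ) : ℕ := ceilPowTwo (64 * Real.logb 2 d)

noncomputable def q₂ (d : ℕ) : ℕ := ceilPowTwo d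

noncomputable def t₂ (d : ℕ) : ℕ :=
  ceilPowTwo (3 * Real.logb 2 d / Real.logb 2 (Real.logb 2 d))

noncomputable def b₁ (d : ℕ) : ℝ := 2 * Real.logb 2 d

noncomputable def b₂ (d : ℕ) : ℝ := 3 * Real.logb 2 (Real.logb 2 d)

/-! ### The matrices -/

/-- The `1 × 2` seed matrix `[1 0]`. -/
def φ : Matrix (Fin 1) (Fin 2) Bool := !![true, false]

/-- The first relaxed interlace, of the seed. -/
noncomputable def M₁ {d s₁ : ℕ} (S₁ : Fin s₁ → Fin (q₁ d) → Fin 2) :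
    Matrix (Fin (q₁ d) × Fin 1) (Fin s₁) Bool :=
  relaxedInterlace φ S₁

/-- The second relaxed interlace, of the transpose of the first. -/
noncomputable def M₂ {d s₁ s₂ : ℕ} (S₁ : Fin s₁ → Fin (q₁ d) → Fin 2)
    (S₂ : Fin s₂ → Fin (q₂ d) → Fin (q₁ d) × Fin 1) :
    Matrix (Fin (q₂ d) × Fin s₁) (Fin s₂) Bool :=
  relaxedInterlace (M₁ S₁)ᵀ S₂

end InterlaceCC

/-! The upper bounds come from the obvious protocol: the column player names a block, then one copy
of the inner matrix is solved. The point is that a dense submatrix does not save even one bit.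

The lower bound is a lifting argument (`not_computes_of_base`). Along a path of a protocol with e
bits left, keep a set J of live blocks, a dense column set U i in each of them, and a dense set V of
rows. A row message halves V. A column message halves each U i, and J is halved when only the blocks
that agree on a dense side are kept. Once |J| ≤ t, balance forces V to show nearly all |C|^|J|
patterns on J, up to its density (`IsBalanced.card_le`). But e bits handle few patterns
(`card_image_restrict_le`): if depth e₀ handles at most Q = |C| · 2^(-c) columns of one block, then
at most Q^|J| · growth (e - e₀) patterns occur, because a row message adds two counts and a column
message multiplies two. As |J| ≥ ρ · 2^e, the growth factor is at most 2^(|J|/(2ρ · 2^e₀)), so there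
is a contradiction if c exceeds 1/(2ρ · 2^e₀) with room for the density of V.

For the seed, e₀ = 0 and c = 1, so any ρ > 1/2 works; this is where column density above 1/2 enters.
For the second interlace, the bound for the first is the base: one bit below its block index, only
about 2/7 of its columns can be handled, so c = 7/4, which beats 100/59. -/

namespace InterlaceCC

/-! ### Operations on protocols -/

namespace Protocol

/-- Exchange the roles of the two players. -/
def swap {X Y : Type} : Protocol X Y → Protocol Y X
  | output v => output v
  | rowMsg f P Q => colMsg f P.swap Q.swap
  | colMsg f P Q => rowMsg f P.swap Q.swap

@[simp]
theorem eval_swap {X Y : Type} (P : Protocol X Y) (x : X) (y : Y) :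
    P.swap.eval y x = P.eval x y := by
  induction P with
  | output v => rfl
  | rowMsg f P Q hP hQ => simp [swap, eval, hP, hQ]
  | colMsg f P Q hP hQ => simp [swap, eval, hP, hQ]

@[simp]
theorem depth_swap {X Y : Type} (P : Protocol X Y) : P.swap.depth = P.depth := by
  induction P with
  | output v => rfl
  | rowMsg f P Q hP hQ => simp [swap, depth, hP, hQ]
  | colMsg f P Q hP hQ => simp [swap, depth, hP, hQ]

/-- Run a protocol on inputs that are (partially) translated to inputs of that protocol. -/
def comap {X Y X' Y' : Type} (u : X' → Option X) (v : Y' → Option Y) :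
    Protocol X Y → Protocol X' Y'
  | output b => output b
  | rowMsg f P Q => rowMsg (fun x => (u x).elim false f) (P.comap u v) (Q.comap u v)
  | colMsg f P Q => colMsg (fun y => (v y).elim false f) (P.comap u v) (Q.comap u v)

theorem eval_comap {X Y X' Y' : Type} {u : X' → Option X} {v : Y' → Option Y}
    (P : Protocol X Y) {x : X} {y : Y} {x' : X'} {y' : Y'} (hx : u x' = some x)
    (hy : v y' = some y) : (P.comap u v).eval x' y' = P.eval x y := by
  induction P with
  | output v => rfl
  | rowMsg f P Q hP hQ => simp [comap, eval, hP, hQ, hx]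
  | colMsg f P Q hP hQ => simp [comap, eval, hP, hQ, hy]

@[simp]
theorem depth_comap {X Y X' Y' : Type} (u : X' → Option X) (v : Y' → Option Y)
    (P : Protocol X Y) : (P.comap u v).depth = P.depth := by
  induction P with
  | output v => rfl
  | rowMsg f P Q hP hQ => simp [comap, depth, hP, hQ]
  | colMsg f P Q hP hQ => simp [comap, depth, hP, hQ]

/-- The row player announces a `k`-bit label of the row; the players go on accordingly. -/
theorem exists_announceRow {X Y : Type} {n : ℕ} (k : ℕ) (g : X → ℕ) (P : ℕ → Protocol X Y)
    (hP : ∀ i, (P i).depth ≤ n) :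
    ∃ Q : Protocol X Y, Q.depth ≤ k + n ∧
      ∀ x y, g x < 2 ^ k → Q.eval x y = (P (g x)).eval x y := by
  induction k generalizing g P with
  | zero =>
    refine ⟨P 0, by simpa using hP 0, fun x y h => ?_⟩
    have : g x = 0 := by simpa using h
    rw [this]
  | succ k ih =>
    obtain ⟨Q₀, hd₀, hQ₀⟩ := ih (fun x => g x / 2) (fun i => P (2 * i)) fun i => hP _
    obtain ⟨Q₁, hd₁, hQ₁⟩ := ih (fun x => g x / 2) (fun i => P (2 * i + 1)) fun i => hP _
    -- The lowest bit of the label is sent first; what remains to be announced is `g x / 2`.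
    refine ⟨rowMsg (fun x => decide (g x % 2 = 1)) Q₀ Q₁, ?_, fun x y h => ?_⟩
    · simp only [depth]
      omega
    · have hlt : g x / 2 < 2 ^ k := by
        rw [pow_succ] at h
        omega
      by_cases hb : g x % 2 = 1
      · simp only [eval, hb, decide_true, if_true, hQ₁ x y hlt]
        congr 2
        omega
      · simp only [eval, hb, decide_false, Bool.false_eq_true, if_false, hQ₀ x y hlt]
        congr 2
        omega

/-- The column player announces a `k`-bit label of the column. -/
theorem exists_announceCol {X Y : Type} {n : ℕ} (k : ℕ) (g : Y → ℕ) (P : ℕ → Protocol X Y)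
    (hP : ∀ i, (P i).depth ≤ n) :
    ∃ Q : Protocol X Y, Q.depth ≤ k + n ∧
      ∀ x y, g y < 2 ^ k → Q.eval x y = (P (g y)).eval x y := by
  obtain ⟨Q, hd, hQ⟩ := exists_announceRow k g (fun i => (P i).swap) (by simpa using hP)
  exact ⟨Q.swap, by simpa using hd, fun x y h => by simpa using hQ y x h⟩

/-- Every matrix with finitely many rows has a protocol. -/
theorem exists_eval_eq {X Y : Type} [Finite X] (M : X → Y → Bool) :
    ∃ P : Protocol X Y, ∀ x y, P.eval x y = M x y := by
  obtain ⟨n, ⟨e⟩⟩ := Finite.exists_equiv_fin X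
  obtain ⟨Q, -, hQ⟩ := exists_announceRow (X := X) (Y := Y) (n := 1) n (fun x => (e x : ℕ))
    (fun i => if h : i < n then
      colMsg (fun y => M (e.symm (⟨i, h⟩ : Fin n)) y) (output false) (output true)
    else output false)
    (fun i => by split_ifs <;> simp [depth])
  refine ⟨Q, fun x y => ?_⟩
  rw [hQ x y ((e x).2.trans Nat.lt_two_pow_self)]
  simp [eval]

end Protocol

/-! ### Complexity and a criterion for robustness -/

theorem comp_le {R C : Type} {M : Matrix R C Bool} {n : ℕ} (P : Protocol R C)
    (hP : ∀ r c, P.eval r c = M r c) (hn : P.depth ≤ n) : comp M ≤ n :=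
  le_trans (Nat.sInf_le (⟨P, rfl, hP⟩ : ∃ Q : Protocol R C, Q.depth = P.depth ∧
    ∀ r c, Q.eval r c = M r c)) hn

/-- Finitely many rows guarantee that some protocol exists, so the infimum is attained rather than
being the default 0 of an empty set. -/
theorem lt_comp {R C : Type} [Finite R] {M : Matrix R C Bool} {n : ℕ}
    (h : ∀ P : Protocol R C, (∀ r c, P.eval r c = M r c) → n < P.depth) : n < comp M := by
  obtain ⟨P₀, hP₀⟩ := Protocol.exists_eval_eq M
  have hne : {k | ∃ P : Protocol R C, P.depth = k ∧ ∀ r c, P.eval r c = M r c}.Nonempty :=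
    ⟨_, P₀, rfl, hP₀⟩
  obtain ⟨P, hd, hP⟩ := Nat.sInf_mem hne
  exact (h P hP).trans_eq hd

/-- Robustness from an upper bound for the matrix and a lower bound for its dense submatrices. -/
theorem isRobust_of_lt_depth {R C : Type} [Fintype R] [DecidableEq R] [Fintype C]
    {δ b : ℝ} {M : Matrix R C Bool} {E : ℕ} (hδ : 0 < δ) (hδ' : δ ≤ 1 / Real.sqrt 2 - 1 / 2)
    (hb : 0 ≤ b) (hub : comp M ≤ E + 1)
    (hlb : ∀ (P : Protocol R C) (A : Finset R) (I : Finset C),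
      (Fintype.card R : ℝ) * 2 ^ (-b) ≤ A.card → (Fintype.card C : ℝ) * (1 / 2 + δ) ≤ I.card →
      (∀ r ∈ A, ∀ c ∈ I, P.eval r c = M r c) → E < P.depth) :
    IsRobust δ b M := by
  classical
  have h2 : (2 : ℝ) ^ (-b) ≤ 1 := Real.rpow_le_one_of_one_le_of_nonpos one_le_two (by linarith)
  have hs : 1 / 2 + δ ≤ 1 := by
    have : 1 / Real.sqrt 2 ≤ 1 := by
      rw [div_le_one (by positivity)]
      exact Real.one_le_sqrt.2 one_le_two
    linarith
  have hR : ⌈(Fintype.card R : ℝ) * 2 ^ (-b)⌉₊ ≤ Fintype.card R :=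
    Nat.ceil_le.2 (mul_le_of_le_one_right (by positivity) h2)
  have hC : ⌈(Fintype.card C : ℝ) ^ 1 * (1 / 2 + δ)⌉₊ ≤ Fintype.card C := by
    rw [pow_one]
    exact Nat.ceil_le.2 (mul_le_of_le_one_right (by positivity) hs)
  refine ⟨hδ, hδ', hb, ?_, ?_⟩
  · refine Nat.one_le_iff_ne_zero.2 (Nat.pos_iff_ne_zero.1 (lt_of_le_of_lt (Nat.zero_le E) ?_))
    refine lt_comp fun P hP => hlb P Finset.univ Finset.univ ?_ ?_ fun r _ c _ => hP r c
    · simpa using mul_le_of_le_one_right (Nat.cast_nonneg (Fintype.card R)) h2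
    · simpa using mul_le_of_le_one_right (Nat.cast_nonneg (Fintype.card C)) hs
  · refine le_csInf ?_ ?_
    -- The infimum over submatrices must be over a nonempty set, or it would be 0.
    · obtain ⟨A, -, hA⟩ := Finset.exists_subset_card_eq
        (s := (Finset.univ : Finset R)) (n := ⌈(Fintype.card R : ℝ) * 2 ^ (-b)⌉₊)
        (by rwa [Finset.card_univ])
      obtain ⟨I, -, hI⟩ := Finset.exists_subset_card_eq
        (s := (Finset.univ : Finset (Fin 1 → C))) (n := ⌈(Fintype.card C : ℝ) ^ 1 * (1 / 2 + δ)⌉₊)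
        (by simpa using hC)
      refine ⟨_, Finset.univ ×ˢ A, I, fun i => ?_, hI, rfl⟩
      rw [← hA]
      congr 1
      ext r
      simp [Subsingleton.elim i 0]
    · rintro _ ⟨R', C', hR', hC', rfl⟩
      refine hub.trans (Nat.succ_le_of_lt (lt_comp fun P hP => ?_))
      -- Inputs outside the submatrix go to `none`; the result is a protocol on all of `M` of the
      -- same depth, correct on the chosen part.
      let u : R → Option {r // r ∈ R'} := fun r =>
        if h : ((0 : Fin 1), r) ∈ R' then some ⟨_, h⟩ else none
      let v : C → Option {c // c ∈ C'} := fun c =>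
        if h : (fun _ => c) ∈ C' then some ⟨_, h⟩ else none
      rw [← Protocol.depth_comap u v]
      refine hlb _ (Finset.univ.filter fun r => ((0 : Fin 1), r) ∈ R')
        (C'.image fun c => c 0) ?_ ?_ ?_
      · rw [hR' 0]
        exact Nat.le_ceil _
      · rw [Finset.card_image_of_injective, hC', pow_one]
        · exact Nat.le_ceil _
        · intro c c' h
          ext i
          rw [Subsingleton.elim i 0]
          exact h
      · intro r hr c hc
        obtain ⟨c', hc', rfl⟩ := Finset.mem_image.1 hc
        have hr' := (Finset.mem_filter.1 hr).2
        have hc'' : (fun _ : Fin 1 => c' 0) = c' := by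
          ext i
          rw [Subsingleton.elim i 0]
        rw [Protocol.eval_comap P (x := ⟨_, hr'⟩) (y := ⟨_, hc''.symm ▸ hc'⟩) (by simp [u, hr'])
          (by simp [v, hc'', hc']), hP]
        rfl

/-! ### Counting patterns -/

/-- A bound for the number of patterns that `j` further bits of communication can handle. -/
def growth : ℕ → ℕ
  | 0 => 1
  | j + 1 => 2 ^ 2 ^ j

/-- Pays for a row message, which adds two pattern counts. -/
theorem two_mul_growth_le (j : ℕ) : 2 * growth j ≤ growth (j + 1) := by
  cases j with
  | zero => simp [growth]
  | succ j =>
    simp only [growth]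
    rw [← pow_succ']
    have := Nat.one_le_two_pow (n := j)
    exact Nat.pow_le_pow_right two_pos (by rw [pow_succ 2 j]; omega)

/-- Pays for a column message, which multiplies the pattern counts of two parts of the blocks. -/
theorem growth_mul_self_le (j : ℕ) : growth j * growth j ≤ growth (j + 1) := by
  cases j with
  | zero => simp [growth]
  | succ j =>
    simp only [growth]
    rw [← pow_add, pow_succ 2 j, mul_two]

theorem growth_le_succ (j : ℕ) : growth j ≤ growth (j + 1) := by
  have := two_mul_growth_le j
  omega

/-- On `V`, the value of `h` is determined by the pair of values of `f` and `g`. -/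
theorem card_image_le_mul_card_image {α β γ ι : Type*} [DecidableEq β] [DecidableEq γ]
    [DecidableEq ι] (V : Finset α) (f : α → β) (g : α → γ) (h : α → ι)
    (H : ∀ k ∈ V, ∀ l ∈ V, f k = f l → g k = g l → h k = h l) :
    (V.image h).card ≤ (V.image f).card * (V.image g).card := by
  rw [← Finset.card_product]
  have h1 : (V.image h).card ≤ (V.image fun k => (f k, g k)).card := by
    refine Finset.card_le_card_of_forall_subsingleton
      (fun (i : ι) (p : β × γ) => ∃ k ∈ V, h k = i ∧ (f k, g k) = p) ?_ ?_
    · intro i hi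
      obtain ⟨k, hk, rfl⟩ := Finset.mem_image.1 hi
      exact ⟨_, Finset.mem_image_of_mem _ hk, k, hk, rfl, rfl⟩
    · rintro p - i ⟨-, k, hk, rfl, hkp⟩ i' ⟨-, l, hl, rfl, hlp⟩
      have := hkp.trans hlp.symm
      exact H k hk l hl (Prod.ext_iff.1 this).1 (Prod.ext_iff.1 this).2
  refine h1.trans (Finset.card_le_card fun p hp => ?_)
  obtain ⟨k, hk, rfl⟩ := Finset.mem_image.1 hp
  exact Finset.mem_product.2 ⟨Finset.mem_image_of_mem _ hk, Finset.mem_image_of_mem _ hk⟩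

theorem card_image_restrict_le_mul {ι κ C : Type*} [DecidableEq C] [DecidableEq ι]
    (V : Finset κ) (S : κ → ι → C) {J J₀ J₁ : Finset ι} (hJ : J ⊆ J₀ ∪ J₁) :
    (V.image fun k => J.restrict (S k)).card ≤
      (V.image fun k => J₀.restrict (S k)).card * (V.image fun k => J₁.restrict (S k)).card := by
  refine card_image_le_mul_card_image _ _ _ _ fun k _ l _ h₀ h₁ => ?_
  ext ⟨i, hi⟩
  rcases Finset.mem_union.1 (hJ hi) with hi' | hi'
  · exact congrFun h₀ ⟨i, hi'⟩
  · exact congrFun h₁ ⟨i, hi'⟩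

theorem card_image_restrict_le_pow {ι κ C : Type*} [DecidableEq C] [DecidableEq ι]
    (V : Finset κ) (S : κ → ι → C) (Q : ℕ) (J : Finset ι)
    (hJ : ∀ i ∈ J, (V.image fun k => S k i).card ≤ Q) :
    (V.image fun k => J.restrict (S k)).card ≤ Q ^ J.card := by
  induction J using Finset.induction_on with
  | empty =>
    simp only [Finset.card_empty, pow_zero]
    exact Finset.card_le_one.2 fun a _ b _ => Subsingleton.elim a b
  | insert i J hi ih =>
    rw [Finset.card_insert_of_notMem hi, pow_succ']
    refine (card_image_le_mul_card_image V (fun k => S k i) (fun k => J.restrict (S k)) _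
      fun k _ l _ h₀ h₁ => ?_).trans (Nat.mul_le_mul (hJ i (Finset.mem_insert_self i J))
        (ih fun i' hi' => hJ i' (Finset.mem_insert_of_mem hi')))
    ext ⟨i', hi'⟩
    rcases Finset.mem_insert.1 hi' with rfl | hi''
    · exact h₀
    · exact congrFun h₁ ⟨i', hi''⟩

/-! ### Lifting lower bounds through a relaxed interlace -/

section Lifting

variable {R C : Type} [DecidableEq C] {q s : ℕ}

/-- On a single block, a protocol for a relaxed interlace is a protocol for the original matrix. -/
theorem card_image_le_of_block {M : Matrix R C Bool} {S : Fin s → Fin q → C} {e Q : ℕ} {θ : ℝ}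
    (hbase : ∀ (P : Protocol C R) (A : Finset R) (I : Finset C), P.depth ≤ e → θ ≤ A.card →
      (∀ c ∈ I, ∀ r ∈ A, P.eval c r = M r c) → I.card ≤ Q)
    (P : Protocol (Fin s) (Fin q × R)) (hP : P.depth ≤ e) (i : Fin q) (A : Finset R)
    (V : Finset (Fin s)) (hA : θ ≤ A.card)
    (hc : ∀ k ∈ V, ∀ r ∈ A, P.eval k (i, r) = M r (S k i)) :
    (V.image fun k => S k i).card ≤ Q := by
  classical
  -- Each symbol is represented by some row of `V` that carries it at coordinate `i`.
  let u : C → Option (Fin s) := fun c =>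
    if h : ∃ k ∈ V, S k i = c then some h.choose else none
  refine hbase (P.comap u fun r => some (i, r)) A _ (by simpa using hP) hA fun c hc' r hr => ?_
  have h : ∃ k ∈ V, S k i = c := by simpa using hc'
  rw [Protocol.eval_comap (u := u) (v := fun r => some (i, r)) P (x := h.choose)
    (y := (i, r)) (by simp only [u, dif_pos h]) rfl,
    hc _ h.choose_spec.1 r hr, h.choose_spec.2]

/-- Few patterns: `j` bits beyond the depth `e` that is too small for a block with more than `Q`
columns leave at most `Q ^ |J| * growth j` patterns on a set `J` of blocks. -/
theorem card_image_restrict_le {M : Matrix R C Bool} {S : Fin s → Fin q → C} {e Q : ℕ} {θ : ℝ}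
    (hθ : 0 ≤ θ)
    (hbase : ∀ (P : Protocol C R) (A : Finset R) (I : Finset C), P.depth ≤ e → θ ≤ A.card →
      (∀ c ∈ I, ∀ r ∈ A, P.eval c r = M r c) → I.card ≤ Q)
    (j : ℕ) (P : Protocol (Fin s) (Fin q × R)) (hP : P.depth ≤ e + j) (J : Finset (Fin q))
    (U : Fin q → Finset R) (V : Finset (Fin s)) (hU : ∀ i ∈ J, 2 ^ j * θ ≤ (U i).card)
    (hc : ∀ k ∈ V, ∀ i ∈ J, ∀ r ∈ U i, P.eval k (i, r) = M r (S k i)) :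
    (V.image fun k => J.restrict (S k)).card ≤ Q ^ J.card * growth j := by
  induction j generalizing P J U V with
  | zero =>
    rw [growth, mul_one]
    exact card_image_restrict_le_pow V S Q J fun i hi =>
      card_image_le_of_block hbase P hP i (U i) V (by simpa using hU i hi)
        fun k hk r hr => hc k hk i hi r hr
  | succ j ih =>
    have hU' : ∀ i ∈ J, 2 ^ j * θ ≤ (U i).card := fun i hi => by
      refine le_trans ?_ (hU i hi)
      gcongr <;> simp
    cases P with
    | output v =>
      exact (ih (.output v) (by simp [Protocol.depth]) J U V hU' hc).trans
        (Nat.mul_le_mul_left _ (growth_le_succ j))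
    | rowMsg f P₀ P₁ =>
      simp only [Protocol.depth] at hP
      have h₀ := ih P₀ (by omega) J U (V.filter fun k => f k = false) hU' fun k hk i hi r hr => by
        have := hc k (Finset.mem_filter.1 hk).1 i hi r hr
        simpa [Protocol.eval, (Finset.mem_filter.1 hk).2] using this
      have h₁ := ih P₁ (by omega) J U (V.filter fun k => f k = true) hU' fun k hk i hi r hr => by
        have := hc k (Finset.mem_filter.1 hk).1 i hi r hr
        simpa [Protocol.eval, (Finset.mem_filter.1 hk).2] using this
      have hV : V = V.filter (fun k => f k = false) ∪ V.filter (fun k => f k = true) := by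
        ext k
        cases h : f k <;> simp [h]
      calc (V.image fun k => J.restrict (S k)).card
          ≤ Q ^ J.card * growth j + Q ^ J.card * growth j := by
            rw [hV, Finset.image_union]
            exact (Finset.card_union_le _ _).trans (add_le_add h₀ h₁)
        _ = Q ^ J.card * (2 * growth j) := by ring
        _ ≤ _ := Nat.mul_le_mul_left _ (two_mul_growth_le j)
    | colMsg f P₀ P₁ =>
      simp only [Protocol.depth] at hP
      let U₀ : Fin q → Finset R := fun i => (U i).filter fun r => f (i, r) = false
      let U₁ : Fin q → Finset R := fun i => (U i).filter fun r => f (i, r) = true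
      -- The two sides add up to `U i`, so a block that fails `p` is dense on its `true` side. Each
      -- subprotocol thus handles one part of `J`.
      let p : Fin q → Prop := fun i => 2 ^ j * θ ≤ (U₀ i).card
      have hsum : ∀ i, ((U₀ i).card : ℝ) + (U₁ i).card = (U i).card := fun i => by
        have := Finset.card_filter_add_card_filter_not (s := U i) (fun r => f (i, r) = false)
        simp only [Bool.not_eq_false] at this
        exact_mod_cast this
      classical
      have h₀ := ih P₀ (by omega) (J.filter p) U₀ V (fun i hi => (Finset.mem_filter.1 hi).2)
        fun k hk i hi r hr => by
          have := hc k hk i (Finset.mem_filter.1 hi).1 r (Finset.mem_filter.1 hr).1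
          simpa [Protocol.eval, (Finset.mem_filter.1 hr).2] using this
      have h₁ := ih P₁ (by omega) (J.filter fun i => ¬ p i) U₁ V (fun i hi => by
          have h1 := hU i (Finset.mem_filter.1 hi).1
          have h2 := not_le.1 (Finset.mem_filter.1 hi).2
          have h3 := hsum i
          rw [pow_succ] at h1
          linarith)
        fun k hk i hi r hr => by
          have := hc k hk i (Finset.mem_filter.1 hi).1 r (Finset.mem_filter.1 hr).1
          simpa [Protocol.eval, (Finset.mem_filter.1 hr).2] using this
      calc (V.image fun k => J.restrict (S k)).card
          ≤ (Q ^ (J.filter p).card * growth j) *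
              (Q ^ (J.filter fun i => ¬ p i).card * growth j) :=
            (card_image_restrict_le_mul V S (Finset.filter_union_filter_not_eq p J).ge).trans
              (Nat.mul_le_mul h₀ h₁)
        _ = Q ^ J.card * (growth j * growth j) := by
            rw [← Finset.card_filter_add_card_filter_not (s := J) p, pow_add]
            ring
        _ ≤ _ := Nat.mul_le_mul_left _ (growth_mul_self_le j)

/-- Each pattern is shared by at most (1 + ε)s/|C|^|J| ≤ 2s/|C|^|J| indices, so a large `V` shows
many patterns. -/
theorem IsBalanced.card_le [Fintype C] {t : ℕ} {ε : ℝ} {S : Fin s → Fin q → C}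
    (hS : IsBalanced t ε S) (hε : ε ≤ 1) (J : Finset (Fin q)) (hJ : J.card ≤ t)
    (V : Finset (Fin s)) :
    (V.card : ℝ) * (Fintype.card C : ℝ) ^ J.card ≤
      (V.image fun k => J.restrict (S k)).card * (2 * s) := by
  obtain ⟨hs, hS⟩ := hS
  have hs' : (0 : ℝ) < s := by exact_mod_cast hs
  rcases Nat.eq_zero_or_pos (Fintype.card C ^ J.card) with h0 | hpos
  · have : (Fintype.card C : ℝ) ^ J.card = 0 := by exact_mod_cast h0
    rw [this, mul_zero]
    positivity
  have hpos' : (0 : ℝ) < (Fintype.card C : ℝ) ^ J.card := by exact_mod_cast hpos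
  rw [← le_div_iff₀ hpos', mul_div_assoc]
  rw [Finset.card_eq_sum_card_image (fun k => J.restrict (S k)) V, Nat.cast_sum]
  refine (Finset.sum_le_card_nsmul _ _ (2 * s / (Fintype.card C : ℝ) ^ J.card) ?_).trans_eq
    (by rw [nsmul_eq_mul])
  intro v hv
  obtain ⟨l, hl, rfl⟩ := Finset.mem_image.1 hv
  have h1 := (abs_le.1 (hS J hJ (S l))).2
  have h2 : ((V.filter fun k => J.restrict (S k) = J.restrict (S l)).card : ℝ) ≤
      (Finset.univ.filter fun k : Fin s => ∀ j ∈ J, S k j = S l j).card := by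
    refine Nat.cast_le.2 (Finset.card_le_card fun k hk => ?_)
    simp only [Finset.mem_filter, Finset.mem_univ, true_and]
    intro j hj
    exact congrFun (Finset.mem_filter.1 hk).2 ⟨j, hj⟩
  refine h2.trans ?_
  rw [mul_comm 2, mul_div_assoc, mul_comm, ← div_le_iff₀ hs']
  have h3 : ε / (Fintype.card C : ℝ) ^ J.card ≤ 1 / (Fintype.card C : ℝ) ^ J.card := by gcongr
  calc _ ≤ 1 / (Fintype.card C : ℝ) ^ J.card + 1 / (Fintype.card C : ℝ) ^ J.card := by linarith
    _ = _ := by ring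

/-- For e > e₀ the exponent of `growth` is 2^(e - e₀ - 1); the -1 yields the factor 2 beside ρ,
without which a density near 1/2 would not suffice. -/
theorem growth_le_rpow {e₀ e a n : ℕ} {ρ : ℝ} (hρ : 0 < ρ) (hn : ρ * 2 ^ (e + a) ≤ n) :
    (growth (e - e₀) : ℝ) ≤ 2 ^ ((n : ℝ) / (2 * ρ * 2 ^ e₀)) := by
  rcases h : e - e₀ with _ | j
  · simpa [growth] using Real.one_le_rpow one_le_two
      (by positivity : 0 ≤ (n : ℝ) / (2 * ρ * 2 ^ e₀))
  · obtain rfl : e = e₀ + j + 1 := by omega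
    simp only [growth]
    push_cast
    rw [← Real.rpow_natCast 2 (2 ^ j)]
    refine Real.rpow_le_rpow_of_exponent_le one_le_two ?_
    push_cast
    rw [le_div_iff₀ (by positivity)]
    refine le_trans ?_ hn
    have ha : (1 : ℝ) ≤ 2 ^ a := one_le_pow₀ one_le_two
    calc (2 : ℝ) ^ j * (2 * ρ * 2 ^ e₀) = ρ * 2 ^ (e₀ + j + 1) * 1 := by ring
      _ ≤ ρ * 2 ^ (e₀ + j + 1) * 2 ^ a := by gcongr
      _ = _ := by ring

/-- The case of few blocks: the number of patterns bounds the density of the rows. -/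
theorem not_computes_of_card_le [Fintype C] [Nonempty C] {M : Matrix R C Bool}
    {S : Fin s → Fin q → C} {t e₀ Q₀ : ℕ} {ε θ K ρ c : ℝ} (hS : IsBalanced t ε S) (hε : ε ≤ 1)
    (hθ : 0 ≤ θ) (hρ : 0 < ρ)
    (hbase : ∀ (P : Protocol C R) (A : Finset R) (I : Finset C), P.depth ≤ e₀ → θ ≤ A.card →
      (∀ c ∈ I, ∀ r ∈ A, P.eval c r = M r c) → I.card ≤ Q₀)
    (hQ₀ : (Q₀ : ℝ) ≤ Fintype.card C * 2 ^ (-c)) {e a : ℕ} (P : Protocol (Fin s) (Fin q × R))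
    (hP : P.depth ≤ e) (J : Finset (Fin q)) (U : Fin q → Finset R) (V : Finset (Fin s))
    (hJ : ρ * 2 ^ (e + a) ≤ J.card) (hJt : J.card ≤ t)
    (hnum : 1 + K + a + J.card / (2 * ρ * 2 ^ e₀) < c * J.card)
    (hV : s * (2 : ℝ) ^ (-(K + a)) ≤ V.card) (hU : ∀ i ∈ J, 2 ^ e * θ ≤ (U i).card)
    (hc : ∀ k ∈ V, ∀ i ∈ J, ∀ r ∈ U i, P.eval k (i, r) = M r (S k i)) : False := by
  have hs : (0 : ℝ) < s := by exact_mod_cast hS.1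
  have hC : (0 : ℝ) < Fintype.card C := by exact_mod_cast Fintype.card_pos
  -- If e < e₀, the truncated difference is 0, and depth e is still within e₀.
  have h1 := card_image_restrict_le hθ hbase (e - e₀) P (by omega) J U V
    (fun i hi => le_trans (by gcongr; exacts [one_le_two, Nat.sub_le _ _]) (hU i hi)) hc
  have h1' : ((V.image fun k => J.restrict (S k)).card : ℝ) ≤
      (Q₀ : ℝ) ^ J.card * growth (e - e₀) := by exact_mod_cast h1
  have h2 := hS.card_le hε J hJt V
  have h3 := growth_le_rpow (e₀ := e₀) hρ hJ
  have key : s * (Fintype.card C : ℝ) ^ J.card * 2 ^ (-(K + a)) ≤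
      s * (Fintype.card C : ℝ) ^ J.card *
        2 ^ (1 + (J.card : ℝ) / (2 * ρ * 2 ^ e₀) - c * J.card) := by
    calc s * (Fintype.card C : ℝ) ^ J.card * 2 ^ (-(K + a))
        = s * 2 ^ (-(K + a)) * (Fintype.card C : ℝ) ^ J.card := by ring
      _ ≤ V.card * (Fintype.card C : ℝ) ^ J.card := by gcongr
      _ ≤ _ := h2
      _ ≤ (Q₀ : ℝ) ^ J.card * growth (e - e₀) * (2 * s) := by gcongr
      _ ≤ (Fintype.card C * 2 ^ (-c)) ^ J.card * 2 ^ ((J.card : ℝ) / (2 * ρ * 2 ^ e₀)) *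
          (2 * s) := by gcongr
      _ = _ := by
        rw [mul_pow, ← Real.rpow_mul_natCast zero_le_two, sub_eq_add_neg,
          Real.rpow_add two_pos, Real.rpow_add two_pos, Real.rpow_one, neg_mul]
        ring
  have := (Real.rpow_le_rpow_left_iff one_lt_two).1 (le_of_mul_le_mul_left key (by positivity))
  linarith

/-- Lifting: a protocol for a dense part of a relaxed interlace needs as many bits as it takes to
single out a block, on top of the depth that the single block needs. Here `e + a` never increases
along a path of the protocol, `a` being the number of messages of the row player. -/
theorem not_computes_of_base [Fintype C] [Nonempty C] {M : Matrix R C Bool}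
    {S : Fin s → Fin q → C} {t e₀ Q₀ Q₁ E : ℕ} {ε θ K ρ c : ℝ} (hS : IsBalanced t ε S) (hε : ε ≤ 1)
    (hθ : 0 ≤ θ) (hρ : 0 < ρ)
    (hbase : ∀ (P : Protocol C R) (A : Finset R) (I : Finset C), P.depth ≤ e₀ → θ ≤ A.card →
      (∀ c ∈ I, ∀ r ∈ A, P.eval c r = M r c) → I.card ≤ Q₀)
    (hzero : ∀ (P : Protocol C R) (A : Finset R) (I : Finset C), P.depth ≤ 0 → θ ≤ A.card →
      (∀ c ∈ I, ∀ r ∈ A, P.eval c r = M r c) → I.card ≤ Q₁)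
    (hQ₀ : (Q₀ : ℝ) ≤ Fintype.card C * 2 ^ (-c))
    (hnum : ∀ a n : ℕ, a ≤ E → ρ * 2 ^ a ≤ n → t < 2 * n → n ≤ t →
      1 + K + a + n / (2 * ρ * 2 ^ e₀) < c * n)
    (hnum0 : 2 * (Q₁ : ℝ) ^ t < Fintype.card C ^ t * 2 ^ (-(K + E)))
    (e a : ℕ) (hea : e + a ≤ E) (P : Protocol (Fin s) (Fin q × R)) (hP : P.depth ≤ e)
    (J : Finset (Fin q)) (U : Fin q → Finset R) (V : Finset (Fin s))
    (hJ : ρ * 2 ^ (e + a) ≤ J.card) (htJ : t < 2 * J.card)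
    (hV : s * (2 : ℝ) ^ (-(K + a)) ≤ V.card) (hU : ∀ i ∈ J, 2 ^ e * θ ≤ (U i).card)
    (hc : ∀ k ∈ V, ∀ i ∈ J, ∀ r ∈ U i, P.eval k (i, r) = M r (S k i)) : False := by
  have hs : (0 : ℝ) < s := by exact_mod_cast hS.1
  have hC : (0 : ℝ) < Fintype.card C := by exact_mod_cast Fintype.card_pos
  induction e generalizing a P J U V with
  | zero =>
    by_cases hJt : J.card ≤ t
    · exact not_computes_of_card_le hS hε hθ hρ hbase hQ₀ P hP J U V hJ hJt
        (hnum a _ (by omega) (le_trans (by gcongr; exacts [one_le_two, by omega]) hJ) htJ hJt)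
        hV hU hc
    -- No bits are left but too many blocks are alive: any t of them show at most Q₁^t patterns,
    -- which `hnum0` rules out.
    · obtain ⟨J', hJ', hcard⟩ := Finset.exists_subset_card_eq (not_le.1 hJt).le
      have h1 := card_image_restrict_le hθ hzero 0 P hP J' U V
        (fun i hi => hU i (hJ' hi)) fun k hk i hi => hc k hk i (hJ' hi)
      have h2 := hS.card_le hε J' hcard.le V
      rw [growth, mul_one, hcard] at h1
      rw [hcard] at h2
      have h1' : ((V.image fun k => J'.restrict (S k)).card : ℝ) ≤ (Q₁ : ℝ) ^ t := by
        exact_mod_cast h1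
      have ha : (2 : ℝ) ^ (-(K + E)) ≤ 2 ^ (-(K + a)) := by
        refine Real.rpow_le_rpow_of_exponent_le one_le_two ?_
        have : (a : ℝ) ≤ E := by exact_mod_cast (by omega : a ≤ E)
        linarith
      have : s * (2 * (Q₁ : ℝ) ^ t) < s * (2 * (Q₁ : ℝ) ^ t) := by
        calc s * (2 * (Q₁ : ℝ) ^ t) < s * (Fintype.card C ^ t * 2 ^ (-(K + E))) := by gcongr
          _ ≤ s * (Fintype.card C ^ t * 2 ^ (-(K + a))) := by gcongr
          _ = s * 2 ^ (-(K + a)) * Fintype.card C ^ t := by ring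
          _ ≤ V.card * Fintype.card C ^ t := by gcongr
          _ ≤ _ := h2
          _ ≤ (Q₁ : ℝ) ^ t * (2 * s) := by gcongr
          _ = _ := by ring
      exact lt_irrefl _ this
  | succ e ih =>
    by_cases hJt : J.card ≤ t
    · exact not_computes_of_card_le hS hε hθ hρ hbase hQ₀ P hP J U V hJ hJt
        (hnum a _ (by omega) (le_trans (by gcongr; exacts [one_le_two, by omega]) hJ) htJ hJt)
        hV hU hc
    have hU' : ∀ i ∈ J, 2 ^ e * θ ≤ (U i).card := fun i hi => by
      refine le_trans ?_ (hU i hi)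
      gcongr <;> simp
    have hJ' : ρ * 2 ^ (e + a) ≤ J.card := by
      refine le_trans ?_ hJ
      gcongr <;> simp
    cases P with
    | output v =>
      exact ih a (by omega) (.output v) (by simp [Protocol.depth]) J U V hJ' htJ hV hU' hc
    | rowMsg f P₀ P₁ =>
      simp only [Protocol.depth] at hP
      have hsum : ((V.filter fun k => f k = false).card : ℝ) + (V.filter fun k => f k = true).card =
          V.card := by
        have := Finset.card_filter_add_card_filter_not (s := V) (fun k => f k = false)
        simp only [Bool.not_eq_false] at this
        exact_mod_cast this
      -- One half of `V` keeps the density for a + 1. As e + a is unchanged, `J` need not shrink.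
      have hhalf : s * (2 : ℝ) ^ (-(K + a)) = 2 * (s * (2 : ℝ) ^ (-(K + (a + 1 : ℕ)))) := by
        have : -(K + a) = -(K + (a + 1 : ℕ)) + 1 := by push_cast; ring
        rw [this, Real.rpow_add_one two_ne_zero]
        ring
      have hJ'' : ρ * 2 ^ (e + (a + 1)) ≤ J.card := by rwa [← add_assoc, add_right_comm]
      by_cases h : s * (2 : ℝ) ^ (-(K + (a + 1 : ℕ))) ≤ (V.filter fun k => f k = false).card
      · refine ih (a + 1) (by omega) P₀ (by omega) J U _ hJ'' htJ h hU' fun k hk i hi r hr => ?_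
        have := hc k (Finset.mem_filter.1 hk).1 i hi r hr
        simpa [Protocol.eval, (Finset.mem_filter.1 hk).2] using this
      · refine ih (a + 1) (by omega) P₁ (by omega) J U (V.filter fun k => f k = true) hJ'' htJ
          (by linarith) hU' fun k hk i hi r hr => ?_
        have := hc k (Finset.mem_filter.1 hk).1 i hi r hr
        simpa [Protocol.eval, (Finset.mem_filter.1 hk).2] using this
    | colMsg f P₀ P₁ =>
      simp only [Protocol.depth] at hP
      let U₀ : Fin q → Finset R := fun i => (U i).filter fun r => f (i, r) = false
      let U₁ : Fin q → Finset R := fun i => (U i).filter fun r => f (i, r) = true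
      let p : Fin q → Prop := fun i => 2 ^ e * θ ≤ (U₀ i).card
      have hsum : ∀ i, ((U₀ i).card : ℝ) + (U₁ i).card = (U i).card := fun i => by
        have := Finset.card_filter_add_card_filter_not (s := U i) (fun r => f (i, r) = false)
        simp only [Bool.not_eq_false] at this
        exact_mod_cast this
      classical
      have hcard := Finset.card_filter_add_card_filter_not (s := J) p
      have hJ₂ : ρ * 2 ^ (e + 1 + a) = 2 * (ρ * 2 ^ (e + a)) := by ring
      -- The side that is dense in at least half of the blocks is followed. Since |J| > t here, t <
      -- 2|J| survives the halving.
      by_cases h : J.card ≤ 2 * (J.filter p).card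
      · have h' : (J.card : ℝ) ≤ 2 * (J.filter p).card := by exact_mod_cast h
        refine ih a (by omega) P₀ (by omega) (J.filter p) U₀ V (by linarith) (by omega) hV
          (fun i hi => (Finset.mem_filter.1 hi).2) fun k hk i hi r hr => ?_
        have := hc k hk i (Finset.mem_filter.1 hi).1 r (Finset.mem_filter.1 hr).1
        simpa [Protocol.eval, (Finset.mem_filter.1 hr).2] using this
      · have h2 : J.card ≤ 2 * (J.filter fun i => ¬ p i).card := by omega
        have h' : (J.card : ℝ) ≤ 2 * (J.filter fun i => ¬ p i).card := by exact_mod_cast h2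
        refine ih a (by omega) P₁ (by omega) (J.filter fun i => ¬ p i) U₁ V (by linarith)
          (by omega) hV (fun i hi => ?_) fun k hk i hi r hr => ?_
        · have h1 := hU i (Finset.mem_filter.1 hi).1
          have h2 := not_le.1 (Finset.mem_filter.1 hi).2
          have h3 := hsum i
          rw [pow_succ] at h1
          linarith
        · have := hc k hk i (Finset.mem_filter.1 hi).1 r (Finset.mem_filter.1 hr).1
          simpa [Protocol.eval, (Finset.mem_filter.1 hr).2] using this

end Lifting

/-! ### Rounding to powers of two, and the seed -/

theorem ceilPowTwo_spec (x : ℝ) :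
    ∃ k : ℕ, ceilPowTwo x = 2 ^ k ∧ x ≤ 2 ^ k ∧ (1 ≤ x → (2 : ℝ) ^ k < 2 * x) := by
  have hne : {n : ℕ | (∃ k : ℕ, n = 2 ^ k) ∧ x ≤ (n : ℝ)}.Nonempty := by
    obtain ⟨k, hk⟩ := pow_unbounded_of_one_lt x (one_lt_two (α := ℝ))
    exact ⟨2 ^ k, ⟨k, rfl⟩, by exact_mod_cast hk.le⟩
  obtain ⟨⟨k, hk⟩, hx⟩ := Nat.sInf_mem hne
  change ceilPowTwo x = 2 ^ k at hk
  change x ≤ (ceilPowTwo x : ℝ) at hx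
  rw [hk] at hx
  refine ⟨k, hk, by exact_mod_cast hx, fun h1 => ?_⟩
  cases k with
  | zero => simp only [pow_zero]; linarith
  | succ k =>
    by_contra! h
    have h' : x ≤ (2 : ℝ) ^ k := by rw [pow_succ] at h; linarith
    have : ceilPowTwo x ≤ 2 ^ k := Nat.sInf_le ⟨⟨k, rfl⟩, by exact_mod_cast h'⟩
    rw [hk] at this
    exact absurd this (not_le.2 (Nat.pow_lt_pow_right one_lt_two k.lt_succ_self))

theorem add_one_sq_le_two_pow {n : ℕ} (hn : 6 ≤ n) : (n + 1) ^ 2 ≤ 2 ^ n := by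
  induction n, hn using Nat.le_induction with
  | base => norm_num
  | succ n hn ih =>
    rw [pow_succ 2 n]
    nlinarith

/-- A few bits do not suffice for a dense part of a relaxed interlace of the seed. -/
theorem not_computes_seed {q s t e : ℕ} {ε l : ℝ} {S : Fin s → Fin q → Fin 2}
    (hS : IsBalanced t ε S) (hε : ε ≤ 1) (hl : 32 ≤ l) (ht : 64 * l ≤ t)
    (he : (2 : ℝ) ^ e < 4 * l ^ 2) (P : Protocol (Fin s) (Fin q × Fin 1)) (hP : P.depth ≤ e)
    (V : Finset (Fin s)) (I : Finset (Fin q × Fin 1)) (hI : 4 / 7 * (2 : ℝ) ^ e ≤ I.card)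
    (htI : t < 2 * I.card) (hV : s * (2 : ℝ) ^ (-(2 * l)) ≤ V.card)
    (hc : ∀ k ∈ V, ∀ i ∈ I, P.eval k i = φ i.2 (S k i.1)) : False := by
  -- For e ≥ 6, (e + 1)² ≤ 2^e < 4l²; smaller e are covered by l ≥ 32.
  have hel : (e : ℝ) + 1 ≤ 2 * l := by
    rcases lt_or_ge e 6 with h | h
    · have : (e : ℝ) < 6 := by exact_mod_cast h
      linarith
    · have h1 : ((e : ℝ) + 1) ^ 2 ≤ 2 ^ e := by exact_mod_cast add_one_sq_le_two_pow h
      nlinarith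
  have hcard : (I.image Prod.fst).card = I.card :=
    Finset.card_image_of_injective _ fun x y h => Prod.ext h (Subsingleton.elim _ _)
  have hbase : ∀ (P : Protocol (Fin 2) (Fin 1)) (A : Finset (Fin 1)) (I : Finset (Fin 2)),
      P.depth ≤ 0 → (1 / 2 ^ e : ℝ) ≤ A.card →
      (∀ c ∈ I, ∀ r ∈ A, P.eval c r = φ r c) → I.card ≤ 1 := by
    intro P A I hP hA hc
    have hA' : 0 < A.card := by
      have : (0 : ℝ) < A.card := lt_of_lt_of_le (by positivity) hA
      exact_mod_cast this
    obtain ⟨r, hr⟩ := Finset.card_pos.1 hA'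
    cases P with
    | output v =>
      refine Finset.card_le_one.2 fun c hcI c' hcI' => ?_
      have h := (hc c hcI r hr).symm.trans (hc c' hcI' r hr)
      revert h
      fin_cases r; fin_cases c <;> fin_cases c' <;> simp [φ]
    | rowMsg f P Q => simp [Protocol.depth] at hP
    | colMsg f P Q => simp [Protocol.depth] at hP
  -- A block has a single seed row, so θ = 1/2^e turns 2^e · θ ≤ |U i| into nonemptiness. A leaf
  -- cannot separate the two seed columns, so Q = 1 and c = 1.
  refine not_computes_of_base (M := φ) (e₀ := 0) (Q₀ := 1) (Q₁ := 1) (E := e) (θ := 1 / 2 ^ e)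
    (K := 2 * l) (ρ := 4 / 7) (c := 1) hS hε (by positivity) (by norm_num) hbase hbase ?_ ?_ ?_
    e 0 le_rfl P hP (I.image Prod.fst) (fun _ => Finset.univ) V (by simpa [hcard] using hI)
    (by rwa [hcard]) (by simpa using hV) ?_ ?_
  · rw [Fintype.card_fin, Real.rpow_neg_one]
    norm_num
  -- The growth term is 7n/8. The remaining n/8 exceeds 4l because n > t/2 ≥ 32l, while 1 + 2l + a ≤
  -- 4l.
  · intro a n ha _ hn _
    have h1 : (a : ℝ) ≤ e := by exact_mod_cast ha
    have h2 : (t : ℝ) < 2 * n := by exact_mod_cast hn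
    rw [pow_zero]
    have : (n : ℝ) / (2 * (4 / 7) * 1) = 7 / 8 * n := by ring
    rw [this]
    linarith
  · rw [Fintype.card_fin, Nat.cast_one, one_pow, mul_one, Nat.cast_ofNat,
      ← Real.rpow_natCast, ← Real.rpow_add two_pos]
    conv_lhs => rw [← Real.rpow_one 2]
    refine Real.rpow_lt_rpow_of_exponent_lt one_lt_two ?_
    linarith
  · intro i _
    simp
  · intro k hk i hi r _
    obtain ⟨⟨i', r'⟩, hi', rfl⟩ := Finset.mem_image.1 hi
    rw [Subsingleton.elim r r']
    exact hc k hk _ hi'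

theorem one_tenth_le : (0.1 : ℝ) ≤ 1 / Real.sqrt 2 - 1 / 2 := by
  have h : Real.sqrt 2 ≤ 5 / 3 := Real.sqrt_le_iff.2 (by norm_num)
  have : (3 / 5 : ℝ) ≤ 1 / Real.sqrt 2 := by
    rw [le_div_iff₀ (by positivity)]
    linarith
  norm_num at this ⊢
  linarith

/-! ### Upper bounds by explicit protocols -/

theorem comp_transpose_relaxedInterlace_seed_le {q s k : ℕ} (hq : q ≤ 2 ^ k)
    (S : Fin s → Fin q → Fin 2) : comp (relaxedInterlace φ S)ᵀ ≤ k + 1 := by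
  obtain ⟨Q, hd, hQ⟩ := Protocol.exists_announceCol (X := Fin s) (Y := Fin q × Fin 1) (n := 1) k
    (fun y => y.1) (fun i => if h : i < q then
      .rowMsg (fun x => φ 0 (S x ⟨i, h⟩)) (.output false) (.output true) else .output false)
    (fun i => by split_ifs <;> simp [Protocol.depth])
  refine comp_le Q (fun r c => ?_) hd
  rw [hQ r c (c.1.2.trans_le hq)]
  obtain ⟨i, j⟩ := c
  rw [Subsingleton.elim j 0]
  simp [Protocol.eval, relaxedInterlace]

/-- The column player names the block, the row player names the entry of the tuple there, and the
column player replies with the value. -/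
theorem comp_transpose_relaxedInterlace_le {q q' s s' k k' : ℕ} (hq : q ≤ 2 ^ k)
    (hq' : q' ≤ 2 ^ k') (M : Matrix (Fin s) (Fin q × Fin 1) Bool)
    (S : Fin s' → Fin q' → Fin q × Fin 1) :
    comp (relaxedInterlace M S)ᵀ ≤ k + k' + 1 := by
  have key : ∀ i : Fin q', ∃ Q : Protocol (Fin s') (Fin q' × Fin s), Q.depth ≤ k + 1 ∧
      ∀ x y, Q.eval x y = M y.2 (S x i) := by
    intro i
    obtain ⟨Q, hd, hQ⟩ := Protocol.exists_announceRow (X := Fin s') (Y := Fin q' × Fin s) (n := 1)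
      k (fun x => (S x i).1) (fun c => if h : c < q then
        .colMsg (fun y => M y.2 (⟨c, h⟩, 0)) (.output false) (.output true) else .output false)
      (fun i => by split_ifs <;> simp [Protocol.depth])
    refine ⟨Q, hd, fun x y => ?_⟩
    rw [hQ x y ((S x i).1.2.trans_le hq), dif_pos (S x i).1.2]
    have : ((⟨(S x i).1, (S x i).1.2⟩, 0) : Fin q × Fin 1) = S x i :=
      Prod.ext rfl (Subsingleton.elim _ _)
    rw [this]
    simp [Protocol.eval]
  choose Q hd hQ using key
  obtain ⟨Q', hd', hQ'⟩ := Protocol.exists_announceCol (X := Fin s') (Y := Fin q' × Fin s)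
    (n := k + 1) k' (fun y => y.1) (fun i => if h : i < q' then Q ⟨i, h⟩ else .output false)
    (fun i => by
      split_ifs
      · exact hd _
      · simp [Protocol.depth])
  refine comp_le Q' (fun r c => ?_) (hd'.trans (by omega))
  rw [hQ' r c (c.1.2.trans_le hq'), dif_pos c.1.2, hQ]
  rfl

/-! ### Robustness of the first interlace -/

theorem t₁_pos (d : ℕ) : 0 < t₁ d := by
  obtain ⟨m, hm, -⟩ := ceilPowTwo_spec (64 * Real.logb 2 d)
  rw [t₁, hm]
  positivity

theorem exists_q₁_add_two {d : ℕ} (hl : 1 ≤ Real.logb 2 d) :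
    ∃ k : ℕ, q₁ d + 2 = 2 ^ k ∧ 2 * Real.logb 2 d ^ 2 ≤ 2 ^ k ∧
      (2 : ℝ) ^ k < 4 * Real.logb 2 d ^ 2 := by
  obtain ⟨k, hk, h1, h2⟩ := ceilPowTwo_spec (2 * Real.logb 2 d ^ 2)
  have h3 : (2 : ℝ) ≤ 2 ^ k := le_trans (by nlinarith) h1
  have h3' : 2 ≤ 2 ^ k := by exact_mod_cast h3
  refine ⟨k, ?_, h1, ?_⟩
  · rw [q₁, hk]
    omega
  · have := h2 (by nlinarith)
    linarith

/-- Both t₁ and q₁ + 2 are powers of two and the second is larger, so 128 log d ≤ 2t₁ ≤ q₁ + 2 < 4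
log² d. For d < 2, q₁ truncates to 0. -/
theorem logb_ge_of_t₁_le_q₁ {d : ℕ} (h : t₁ d ≤ q₁ d) : 32 ≤ Real.logb 2 d := by
  rcases lt_or_ge d 2 with hd | hd
  · have hlog : Real.logb 2 d = 0 := by interval_cases d <;> simp
    have : ceilPowTwo (2 * Real.logb 2 d ^ 2) ≤ 1 :=
      Nat.sInf_le ⟨⟨0, rfl⟩, by simp [hlog]⟩
    have h1 := t₁_pos d
    rw [q₁] at h
    omega
  · have hl : 1 ≤ Real.logb 2 d := by
      rw [Real.le_logb_iff_rpow_le one_lt_two (by positivity), Real.rpow_one]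
      exact_mod_cast hd
    obtain ⟨k, hk, h1, h2⟩ := exists_q₁_add_two hl
    obtain ⟨m, hm, h3, -⟩ := ceilPowTwo_spec (64 * Real.logb 2 d)
    have hmk : 2 ^ m < 2 ^ k := by
      rw [t₁, hm] at h
      omega
    have : 2 ^ (m + 1) ≤ 2 ^ k :=
      Nat.pow_le_pow_right two_pos ((Nat.pow_lt_pow_iff_right one_lt_two).1 hmk)
    have h5 : (2 : ℝ) ^ m * 2 ≤ 2 ^ k := by rw [← pow_succ]; exact_mod_cast this
    nlinarith

theorem isRobust_M₁ {d s₁ : ℕ} {ε₁ : ℝ} (S₁ : Fin s₁ → Fin (q₁ d) → Fin 2) (h : t₁ d ≤ q₁ d)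
    (hε : ε₁ ≤ 1) (hS : IsBalanced (t₁ d) ε₁ S₁) : IsRobust 0.1 (b₁ d) (M₁ S₁)ᵀ := by
  have hl := logb_ge_of_t₁_le_q₁ h
  obtain ⟨k, hk, h1, h2⟩ := exists_q₁_add_two (by linarith : 1 ≤ Real.logb 2 d)
  obtain ⟨m, hm, h3, -⟩ := ceilPowTwo_spec (64 * Real.logb 2 d)
  have hk' : (q₁ d : ℝ) + 2 = 2 ^ k := by exact_mod_cast hk
  refine isRobust_of_lt_depth (E := k) (by norm_num) one_tenth_le (by rw [b₁]; linarith)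
    (comp_transpose_relaxedInterlace_seed_le (by omega) S₁) fun P A I hA hI hc => ?_
  by_contra! hP
  rw [Fintype.card_prod, Fintype.card_fin, Fintype.card_fin, mul_one] at hI
  have hI' : (3 / 5 : ℝ) * q₁ d ≤ I.card := by norm_num at hI; linarith
  refine not_computes_seed hS hε hl ?_ h2 P hP A I ?_ ?_ ?_ fun k hk i hi => hc k hk i hi
  · rw [t₁, hm]
    exact_mod_cast h3
  -- 3/5 · (2^k - 2) ≥ 4/7 · 2^k once 2^k ≥ 42, and 2^k ≥ 2 log² d is far larger.
  · nlinarith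
  · have h4 : (t₁ d : ℝ) ≤ q₁ d := by exact_mod_cast h
    have h5 : (0 : ℝ) < t₁ d := by exact_mod_cast t₁_pos d
    have : (t₁ d : ℝ) < 2 * I.card := by linarith
    exact_mod_cast this
  · simpa [b₁] using hA

/-! ### Estimates for large d -/

open Filter in
theorem eventually_mul_logb_sq_le (c : ℝ) : ∀ᶠ x : ℝ in atTop, c * Real.logb 2 x ^ 2 ≤ x := by
  have h := (Real.isLittleO_pow_log_id_atTop (n := 2)).bound
    (show (0 : ℝ) < Real.log 2 ^ 2 / (|c| + 1) by
      have := Real.log_pos one_lt_two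
      positivity)
  filter_upwards [h, eventually_ge_atTop (0 : ℝ)] with x hx h0
  have hlog : 0 < Real.log 2 ^ 2 := by
    have := Real.log_pos one_lt_two
    positivity
  rw [Real.norm_of_nonneg (by positivity), id, Real.norm_of_nonneg h0, div_mul_eq_mul_div,
    le_div_iff₀ (by positivity)] at hx
  rw [Real.logb, div_pow, mul_div_assoc', div_le_iff₀ hlog]
  calc c * Real.log x ^ 2 ≤ Real.log x ^ 2 * (|c| + 1) := by
        rw [mul_comm]
        gcongr
        linarith [le_abs_self c]
    _ ≤ _ := by linarith

/-- The conditions under which `d` is large enough. -/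
def IsLarge (d : ℕ) : Prop :=
  21 ≤ Real.logb 2 (Real.logb 2 d) ∧ 200 * Real.logb 2 (Real.logb 2 d) ^ 2 ≤ Real.logb 2 d ∧
    800 * Real.logb 2 d ^ 2 ≤ d

open Filter in
theorem eventually_isLarge : ∀ᶠ d : ℕ in atTop, IsLarge d := by
  have h1 : Tendsto (fun d : ℕ => Real.logb 2 d) atTop atTop :=
    (Real.tendsto_logb_atTop one_lt_two).comp tendsto_natCast_atTop_atTop
  have h2 := (Real.tendsto_logb_atTop one_lt_two).comp h1
  filter_upwards [h2.eventually_ge_atTop 21, h1.eventually (eventually_mul_logb_sq_le 200),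
    tendsto_natCast_atTop_atTop.eventually (eventually_mul_logb_sq_le 800)] with d h h' h''
  exact ⟨h, h', h''⟩

theorem le_of_two_pow_le {x y : ℝ} {n k : ℕ} (hx : 0 < x) (h : (2 : ℝ) ^ n ≤ 2 ^ k * x ^ 3)
    (hy : y = Real.logb 2 x) : (n : ℝ) ≤ k + 3 * y := by
  have h' := Real.logb_le_logb_of_le one_lt_two (by positivity) h
  rw [Real.logb_mul (by positivity) (by positivity), Real.logb_pow, Real.logb_pow, Real.logb_pow,
    Real.logb_self_eq_one one_lt_two, ← hy] at h'
  push_cast at h'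
  linarith

/-- Few blocks: the depth of the rows is negligible against the number of blocks. -/
theorem few_blocks_bound {l m n t a : ℝ} {x : ℝ} {i k : ℕ} (hm : 21 ≤ m) (hml : 200 * m ^ 2 ≤ l)
    (hm' : m = Real.logb 2 l) (ht : 3 * l ≤ t * m) (htl : t ≤ l) (hx : x = 2 ^ k)
    (hxl : x < 4 * l ^ 2) (ha : a = i) (hn : 59 / 100 / x * 2 ^ i ≤ n) (htn : t < 2 * n)
    (hnt : n ≤ t) : 1 + 3 * m + a + 100 / 59 * n < 7 / 4 * n := by
  have hl : 0 < l := by nlinarith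
  have hx0 : 0 < x := by rw [hx]; positivity
  -- From n ≤ t ≤ l and x < 4l², 2^a ≤ 100/59 · n · x < 8l³.
  have ha' : a ≤ 3 + 3 * m := by
    rw [ha]
    refine le_of_two_pow_le (k := 3) hl ?_ hm'
    rw [div_mul_eq_mul_div, div_le_iff₀ hx0] at hn
    have h : n * x ≤ l * (4 * l ^ 2) := by
      gcongr
      exact hnt.trans htl
    have h3 : 0 < l ^ 3 := by positivity
    linarith
  -- 1/20 lies below the gap 7/4 - 100/59, and n > t/2 ≥ 3l/(2m) ≥ 300m.
  have h2 : 4 + 6 * m < 1 / 20 * n := by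
    by_contra! h
    have h3 : 1 / 20 * n * m ≤ (4 + 6 * m) * m := by gcongr
    have h4 : t * m ≤ 2 * n * m := by gcongr
    nlinarith
  linarith

/-- Many blocks: the number of patterns that need no communication is negligible. -/
theorem many_blocks_bound {l m t r q d : ℝ} {n k k₂ : ℕ} (hm : 21 ≤ m) (hml : 200 * m ^ 2 ≤ l)
    (hm' : m = Real.logb 2 l) (ht : 3 * l ≤ t * m) (htn : t = n)
    (hr : 0 ≤ r) (hrl : r < 2 * (64 * l)) (hq : l ^ 2 ≤ q) (hk : (2 : ℝ) ^ k < 4 * l ^ 2)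
    (hl : l = Real.logb 2 d) (hd : 0 < d) (hk₂ : (2 : ℝ) ^ k₂ < 2 * d) :
    2 * r ^ n < q ^ n * 2 ^ (-(3 * m + (k + k₂ : ℕ))) := by
  have hl0 : 88200 ≤ l := by nlinarith
  have hq0 : 0 < q := by nlinarith
  have h2m : (2 : ℝ) ^ m = l := by
    rw [hm', Real.rpow_logb two_pos (by norm_num) (by linarith)]
  -- The power is 128/l, and r < 128l is compared with q ≥ l².
  have h1 : r ≤ q * 2 ^ (7 - m) := by
    rw [Real.rpow_sub two_pos, h2m, mul_div_assoc', le_div_iff₀ (by linarith)]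
    norm_num
    nlinarith
  have hk1 : (k : ℝ) ≤ 2 + 3 * m := by
    refine le_of_two_pow_le (k := 2) (by linarith : 0 < l) ?_ hm'
    have : l ^ 2 * 1 ≤ l ^ 2 * l := by gcongr; linarith
    linarith
  have hk2 : (k₂ : ℝ) ≤ 1 + l := by
    have h' := Real.logb_le_logb_of_le one_lt_two (by positivity) hk₂.le
    rw [Real.logb_mul (by positivity) (by positivity), Real.logb_pow,
      Real.logb_self_eq_one one_lt_two, ← hl] at h'
    linarith
  have ht0 : 0 ≤ t := by rw [htn]; positivity
  have h7 : 21 * t ≤ m * t := by gcongr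
  have hml' : 4200 * m ≤ l := by nlinarith
  -- Each of the t coordinates gains m - 7 ≥ 2m/3 bits, at least 2l in total, against a need of only
  -- l + O(m).
  have hexp : 1 + (7 - m) * n < -(3 * m + (k + k₂ : ℕ)) := by
    rw [← htn]
    push_cast
    linarith
  calc 2 * r ^ n ≤ 2 * (q * 2 ^ (7 - m)) ^ n := by gcongr
    _ = q ^ n * 2 ^ (1 + (7 - m) * n) := by
      rw [mul_pow, ← Real.rpow_mul_natCast zero_le_two, Real.rpow_add two_pos, Real.rpow_one]
      ring
    _ < _ := mul_lt_mul_of_pos_left (Real.rpow_lt_rpow_of_exponent_lt one_lt_two hexp)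
      (by positivity)

/-! ### Robustness of the second interlace -/

theorem card_eq_sum_card_block {q s : ℕ} (I : Finset (Fin q × Fin s)) :
    I.card = ∑ i, (Finset.univ.filter fun r => (i, r) ∈ I).card := by
  simp_rw [Finset.card_filter]
  rw [← Fintype.sum_prod_type (f := fun p => if p ∈ I then 1 else 0), ← Finset.card_filter]
  simp

/-- A set that is dense in `[q] × [s]` is dense in many of the blocks. -/
theorem le_card_filter_block {q s : ℕ} (hs : 0 < s) {x y : ℝ} (hx : 0 ≤ x)
    (I : Finset (Fin q × Fin s)) (hI : (x + y) * (q * s) ≤ I.card) :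
    y * q ≤ (Finset.univ.filter fun i : Fin q =>
      x * s ≤ ((Finset.univ.filter fun r => (i, r) ∈ I).card : ℝ)).card := by
  have hs' : (0 : ℝ) < s := by exact_mod_cast hs
  set J := Finset.univ.filter fun i : Fin q =>
      x * s ≤ ((Finset.univ.filter fun r => (i, r) ∈ I).card : ℝ) with hJ
  have h1 : (I.card : ℝ) ≤ ∑ i : Fin q, (x * s + if i ∈ J then (s : ℝ) else 0) := by
    rw [card_eq_sum_card_block, Nat.cast_sum]
    refine Finset.sum_le_sum fun i _ => ?_
    split_ifs with h
    · have : ((Finset.univ.filter fun r => (i, r) ∈ I).card : ℝ) ≤ s := by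
        exact_mod_cast (Finset.card_le_univ _).trans_eq (Fintype.card_fin s)
      have : 0 ≤ x * s := by positivity
      linarith
    · simp only [hJ, Finset.mem_filter, Finset.mem_univ, true_and, not_le] at h
      linarith
  rw [Finset.sum_add_distrib, Finset.sum_const, Finset.card_univ, Fintype.card_fin, nsmul_eq_mul,
    Finset.sum_ite_mem, Finset.univ_inter, Finset.sum_const, nsmul_eq_mul] at h1
  refine le_of_mul_le_mul_right ?_ hs'
  linarith

theorem isRobust_M₂ {d s₁ s₂ : ℕ} {ε₁ ε₂ : ℝ} (S₁ : Fin s₁ → Fin (q₁ d) → Fin 2)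
    (S₂ : Fin s₂ → Fin (q₂ d) → Fin (q₁ d) × Fin 1) (hd : IsLarge d) (hε₁ : ε₁ ≤ 1) (hε₂ : ε₂ ≤ 1)
    (hS₁ : IsBalanced (t₁ d) ε₁ S₁) (hS₂ : IsBalanced (t₂ d) ε₂ S₂) :
    IsRobust 0.1 (b₂ d) (M₂ S₁ S₂)ᵀ := by
  obtain ⟨hm, hml, hld⟩ := hd
  obtain ⟨k₁, hk₁, hk₁l, hk₁u⟩ := exists_q₁_add_two (d := d) (by nlinarith)
  set l := Real.logb 2 d with hl
  set m := Real.logb 2 l with hm'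
  have hl88 : 88200 ≤ l := by nlinarith
  have hll : 88200 * l ≤ l ^ 2 := by rw [sq]; gcongr
  have hd0 : (0 : ℝ) < d := by linarith
  obtain ⟨k₂, hk₂, hk₂l, hk₂u⟩ := ceilPowTwo_spec d
  replace hk₂u := hk₂u (by linarith)
  obtain ⟨i₁, hi₁, hi₁l, hi₁u⟩ := ceilPowTwo_spec (64 * l)
  replace hi₁u := hi₁u (by linarith)
  obtain ⟨i₂, hi₂, hi₂l, hi₂u⟩ := ceilPowTwo_spec (3 * l / m)
  have hlm : m ≤ l := by nlinarith
  replace hi₂u := hi₂u (by rw [le_div_iff₀ (by linarith)]; linarith)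
  have hq₁ : (q₁ d : ℝ) = 2 ^ k₁ - 2 := by
    rw [eq_sub_iff_add_eq]
    exact_mod_cast hk₁
  have hq₂ : (q₂ d : ℝ) = 2 ^ k₂ := by rw [q₂, hk₂]; push_cast; rfl
  have ht₁ : (t₁ d : ℝ) = 2 ^ i₁ := by rw [t₁, hi₁]; push_cast; rfl
  have ht₂ : (t₂ d : ℝ) = 2 ^ i₂ := by rw [t₂, hi₂]; push_cast; rfl
  rw [← ht₁] at hi₁l hi₁u
  rw [← ht₂] at hi₂l hi₂u
  have hs₁ : (0 : ℝ) < s₁ := by exact_mod_cast hS₁.1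
  have hd2 : (2 : ℝ) ^ (-(2 * l)) = 1 / d ^ 2 := by
    rw [Real.rpow_neg zero_le_two, mul_comm, Real.rpow_mul zero_le_two, hl,
      Real.rpow_logb two_pos (by norm_num) hd0]
    norm_num
  obtain ⟨k, rfl⟩ : ∃ k, k₁ = k + 1 := by
    refine Nat.exists_eq_succ_of_ne_zero fun h => ?_
    rw [h, pow_zero] at hk₁l
    linarith
  have hbase : ∀ (e : ℕ) (P : Protocol (Fin (q₁ d) × Fin 1) (Fin s₁)) (A : Finset (Fin s₁))
      (I : Finset (Fin (q₁ d) × Fin 1)), (2 : ℝ) ^ e ≤ 2 ^ (k + 1) → 4 / 7 * (2 : ℝ) ^ e ≤ I.card →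
      t₁ d < 2 * I.card → P.depth ≤ e → s₁ * (2 : ℝ) ^ (-(2 * l)) ≤ A.card →
      (∀ c ∈ I, ∀ r ∈ A, P.eval c r = (M₁ S₁)ᵀ r c) → False := by
    intro e P A I he hI htI hP hA hc
    refine not_computes_seed hS₁ hε₁ (by linarith) hi₁l (he.trans_lt hk₁u) P.swap (by simpa) A I hI
      htI hA fun r hr c hcI => ?_
    rw [Protocol.eval_swap]
    exact hc c hcI r hr
  refine isRobust_of_lt_depth (E := k + 1 + k₂) (by norm_num) one_tenth_le
    (by rw [b₂]; linarith) (comp_transpose_relaxedInterlace_le (by omega) hk₂.le _ S₂)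
    fun P A I hA hI hc => ?_
  by_contra! hP
  rw [Fintype.card_prod, Fintype.card_fin, Fintype.card_fin] at hI
  rw [Fintype.card_fin] at hA
  push_cast at hI
  set θ : ℝ := s₁ * (2 : ℝ) ^ (-(2 * l)) with hθ
  set U : Fin (q₂ d) → Finset (Fin s₁) := fun i => Finset.univ.filter fun r => (i, r) ∈ I with hU
  -- The initial density 1/100 of a block must survive E halvings and still exceed 1/d²; since 2^E ≤
  -- 8l²d, this is the condition 800l² ≤ d.
  have hθ' : 2 ^ (k + 1 + k₂) * θ ≤ 1 / 100 * s₁ := by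
    rw [hθ, hd2, pow_add]
    calc (2 : ℝ) ^ (k + 1) * 2 ^ k₂ * (s₁ * (1 / d ^ 2))
        ≤ 4 * l ^ 2 * (2 * d) * (s₁ * (1 / d ^ 2)) := by gcongr
      _ = 8 * l ^ 2 * (s₁ / d) := by field_simp; ring
      _ ≤ 1 / 100 * d * (s₁ / d) :=
        mul_le_mul_of_nonneg_right (by linarith) (by positivity)
      _ = _ := by field_simp
  -- The density 1/2 + δ = 3/5 is split as 1/100 within a block and 59/100 for the share of dense
  -- blocks.
  have hJ := le_card_filter_block hS₁.1 (x := 1 / 100) (y := 59 / 100) (by norm_num) I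
    (by norm_num at hI ⊢; linarith)
  set J := Finset.univ.filter fun i : Fin (q₂ d) => 1 / 100 * (s₁ : ℝ) ≤ (U i).card with hJ'
  have hne : Nonempty (Fin (q₁ d) × Fin 1) := by
    have : (0 : ℝ) < q₁ d := by rw [hq₁]; linarith
    exact ⟨⟨0, by exact_mod_cast this⟩, 0⟩
  have hn3 : 3 * l ≤ t₂ d * m := by rwa [div_le_iff₀ (by linarith)] at hi₂l
  have ht₂l : (t₂ d : ℝ) ≤ l := by
    refine hi₂u.le.trans ?_
    rw [mul_div_assoc', div_le_iff₀ (by linarith)]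
    have : l * 21 ≤ l * m := by gcongr
    linarith
  -- Depth k handles at most 4/7 · 2^k = 2/7 · 2^(k+1) columns of a block, by `hbase`. The value of
  -- ρ makes ρ · 2^E equal to 59/100 · q₂.
  refine not_computes_of_base (M := (M₁ S₁)ᵀ) (e₀ := k) (Q₀ := ⌊(2 / 7 : ℝ) * 2 ^ (k + 1)⌋₊)
    (Q₁ := t₁ d) (E := k + 1 + k₂) (θ := θ) (K := 3 * m) (ρ := 59 / 100 / 2 ^ (k + 1))
    (c := 7 / 4) hS₂ hε₂ (by positivity) (by positivity) ?_ ?_ ?_ ?_ ?_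
    (k + 1 + k₂) 0 le_rfl P hP J U A ?_ ?_ ?_ ?_ ?_
  · intro P A I hP hA hc
    by_contra! hI
    have hI' := (Nat.floor_lt (by positivity)).1 hI
    have : (t₁ d : ℝ) < 2 * I.card := by linarith
    refine hbase k P A I (pow_le_pow_right₀ one_le_two k.le_succ)
      (by rw [pow_succ] at hI'; linarith) ?_ hP hA hc
    exact_mod_cast this
  -- At depth 0 the only real constraint in `hbase` is t₁ < 2|I|, so Q₁ = t₁ is enough.
  · intro P A I hP hA hc
    by_contra! hI
    refine hbase 0 P A I (pow_le_pow_right₀ one_le_two (Nat.zero_le _)) ?_ (by omega) hP hA hc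
    have : (1 : ℝ) ≤ I.card := by exact_mod_cast (by omega : 1 ≤ I.card)
    linarith
  · rw [Fintype.card_prod, Fintype.card_fin, Fintype.card_fin, mul_one]
    refine (Nat.floor_le (by positivity)).trans ?_
    -- 2/7 · 3.4 < 1 leaves room for the -2 in q₁.
    have h1 : (2 : ℝ) ^ (7 / 4 : ℝ) ≤ 3.4 := by
      refine le_of_pow_le_pow_left₀ (n := 4) (by norm_num) (by norm_num) ?_
      rw [← Real.rpow_mul_natCast zero_le_two]
      norm_num
    rw [Real.rpow_neg zero_le_two, ← div_eq_mul_inv, le_div_iff₀ (by positivity)]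
    calc (2 / 7 : ℝ) * 2 ^ (k + 1) * 2 ^ (7 / 4 : ℝ) ≤ 2 / 7 * 2 ^ (k + 1) * 3.4 := by gcongr
      _ ≤ _ := by rw [hq₁]; norm_num; linarith
  · intro a n ha hn htn hnt
    have htn' : (t₂ d : ℝ) < 2 * n := by exact_mod_cast htn
    have hnt' : (n : ℝ) ≤ t₂ d := by exact_mod_cast hnt
    have h1 : (n : ℝ) / (2 * (59 / 100 / 2 ^ (k + 1)) * 2 ^ k) = 100 / 59 * n := by
      rw [pow_succ]
      field_simp
    rw [h1]
    exact few_blocks_bound hm hml hm' hn3 ht₂l rfl hk₁u rfl hn htn' hnt'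
  · rw [Fintype.card_prod, Fintype.card_fin, Fintype.card_fin, mul_one]
    exact many_blocks_bound hm hml hm' hn3 rfl (Nat.cast_nonneg _) hi₁u
      (by rw [hq₁]; linarith) hk₁u hl hd0 hk₂u
  · have : (59 / 100 : ℝ) / 2 ^ (k + 1) * 2 ^ (k + 1 + k₂ + 0) = 59 / 100 * q₂ d := by
      rw [add_zero, pow_add, hq₂]
      field_simp
      ring
    rw [this]
    exact hJ
  · have : (t₂ d : ℝ) < 2 * J.card := by rw [hq₂] at hJ; linarith
    exact_mod_cast this
  · simpa [b₂] using hA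
  · intro i hi
    exact hθ'.trans (Finset.mem_filter.1 hi).2
  · intro r hr i hi x hx
    exact hc r hr (i, x) (Finset.mem_filter.1 hx).2

end InterlaceCC

theorem mainTheorem7 :
    (∀ (d s₁ : ℕ) (ε₁ : ℝ) (S₁ : Fin s₁ → Fin (InterlaceCC.q₁ d) → Fin 2),
      InterlaceCC.t₁ d ≤ InterlaceCC.q₁ d →
      0 ≤ ε₁ → ε₁ ≤ 1 →
      InterlaceCC.IsBalanced (InterlaceCC.t₁ d) ε₁ S₁ →
      InterlaceCC.IsRobust 0.1 (InterlaceCC.b₁ d) (InterlaceCC.M₁ S₁)ᵀ) ∧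
    (∃ d₀ : ℕ, ∀ d : ℕ, d₀ ≤ d →
      ∀ (s₁ s₂ : ℕ) (ε₁ ε₂ : ℝ) (S₁ : Fin s₁ → Fin (InterlaceCC.q₁ d) → Fin 2)
        (S₂ : Fin s₂ → Fin (InterlaceCC.q₂ d) → Fin (InterlaceCC.q₁ d) × Fin 1),
      0 ≤ ε₁ → ε₁ ≤ 1 → 0 ≤ ε₂ → ε₂ ≤ 1 →
      InterlaceCC.IsBalanced (InterlaceCC.t₁ d) ε₁ S₁ →
      InterlaceCC.IsBalanced (InterlaceCC.t₂ d) ε₂ S₂ →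
      InterlaceCC.IsRobust 0.1 (InterlaceCC.b₂ d) (InterlaceCC.M₂ S₁ S₂)ᵀ) := by
  refine ⟨fun d s₁ ε₁ S₁ h _ hε hS => InterlaceCC.isRobust_M₁ S₁ h hε hS, ?_⟩
  obtain ⟨d₀, hd₀⟩ := Filter.eventually_atTop.1 InterlaceCC.eventually_isLarge
  exact ⟨d₀, fun d hd s₁ s₂ ε₁ ε₂ S₁ S₂ _ h₁ _ h₂ hS₁ hS₂ =>
    InterlaceCC.isRobust_M₂ S₁ S₂ (hd₀ d hd) h₁ h₂ hS₁ hS₂⟩
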